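/- Let $(G,+,-,0,<)$ be a (linearly) ordered abelian group and let $H \subsetneq G$ be a proper convex subgroup. For $a,b\in G$ write $a\sim b$ if $|a|\le n|b|$ and $|b|\le n|a|$ for some natural number $n$, let $[a]$ be the $\sim$-class of $a$, and order the set $G/{\sim}$ by $[a]<[b]$ iff $|a|>|b|$ and $a\not\sim b$. For a convex subgroup $C$ of $G$ put $\Phi_G(C)=\{[a] : a\in C\setminus\{0\}\}\subseteq G/{\sim}$. An abelian group $A$ is called $n$-divisible if $nA=A$. The quotient $G/H$ carries the induced ordering. A subset of $G$ is called $\mathcal{L}_{\mathrm{og}}$-definable if it is definable in $G$ by a first-order formula, with parameters from $G$, in the language $\mathcal{L}_{\mathrm{og}}=\{+,-,0,<\}$ of ordered groups. Then the following hold. 1. If $\Phi_G(G)\setminus\Phi_G(H)$ has a maximum and there is an integer $n\ge 2$ such that $G/H$ has no non-trivial $n$-divisible convex subgroup, then $H$ is $\mathcal{L}_{\mathrm{og}}$-definable. 2. If for some integer $n\ge 2$ the quotient $G/H$ has a non-trivial $n$-divisible convex subgroup, $\Phi_G(H)$ does not have a minimum, and for every convex subgroup $H'\subsetneq H$ the quotient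 $H/H'$ is not $n$-divisible, then $H$ is $\mathcal{L}_{\mathrm{og}}$-definable. 3. If for some integer $n\ge 2$ the quotient $G/H$ has no non-trivial $n$-divisible convex subgroup and $\Phi_G(H)$ has a minimum, then $H$ is $\mathcal{L}_{\mathrm{og}}$-definable. 4. If for some integer $n\ge 2$ the quotient $G/H$ has no non-trivial $n$-divisible convex subgroup and for some convex subgroup $H'\subsetneq H$ the quotient $H/H'$ is $n$-divisible, then $H$ is $\mathcal{L}_{\mathrm{og}}$-definable. -/

import Mathlib

namespace OrderedGroupDefinability

/-! ### The language of ordered groups -/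

/-- Function symbols `0`, `-` (unary) and `+`. -/
inductive LogFunc : ℕ → Type
  | zero : LogFunc 0
  | neg : LogFunc 1
  | add : LogFunc 2

/-- The only relation symbol `<`. -/
inductive LogRel : ℕ → Type
  | lt : LogRel 2

/-- The first-order language `{+, -, 0, <}` of ordered groups. -/
def Log : FirstOrder.Language where
  Functions := LogFunc
  Relations := LogRel

/-- An ordered abelian group as a structure in the language of ordered groups. -/
instance logStructure (G : Type*) [AddCommGroup G] [LinearOrder G] : Log.Structure G where
  funMap
    | LogFunc.zero, _ => 0
    | LogFunc.neg, v => -(v 0)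
    | LogFunc.add, v => v 0 + v 1
  RelMap
    | LogRel.lt, v => v 0 < v 1

/-! ### Convex subgroups and their quotients -/

/-- Convex subgroups of an ordered abelian group. -/
structure ConvexAddSubgroup (G : Type*) [AddCommGroup G] [LinearOrder G]
    extends AddSubgroup G where
  ordConnected' : carrier.OrdConnected

section Quotient

variable {G : Type*} [AddCommGroup G] [LinearOrder G] [IsOrderedAddMonoid G]

/-- The order on `G ⧸ H`: one coset is at most another iff this holds for some pair of
representatives. -/
instance quotientLE (H : ConvexAddSubgroup G) : LE (G ⧸ H.toAddSubgroup) where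
  le x y := ∃ a b : G, (a : G ⧸ H.toAddSubgroup) = x ∧ (b : G ⧸ H.toAddSubgroup) = y ∧ a ≤ b

theorem quotient_mk_le_mk (H : ConvexAddSubgroup G) (a b : G) :
    (a : G ⧸ H.toAddSubgroup) ≤ (b : G ⧸ H.toAddSubgroup) ↔
      ∃ h ∈ H.toAddSubgroup, a ≤ b + h := by
  constructor
  · rintro ⟨a', b', ha, hb, hab⟩
    rw [QuotientAddGroup.eq] at ha hb
    refine ⟨(-a' + a) - (-b' + b), H.toAddSubgroup.sub_mem ha hb, ?_⟩
    have h1 : b + ((-a' + a) - (-b' + b)) = a + (b' - a') := by abel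
    rw [h1]
    exact le_add_of_nonneg_right (sub_nonneg.2 hab)
  · rintro ⟨h, hh, hab⟩
    exact ⟨a, b + h, rfl, by simpa [QuotientAddGroup.eq] using hh, hab⟩

/-- The induced linear order on the quotient by a convex subgroup. -/
noncomputable instance quotientLinearOrder (H : ConvexAddSubgroup G) :
    LinearOrder (G ⧸ H.toAddSubgroup) where
  le_refl x := by
    induction x using QuotientAddGroup.induction_on with
    | H a => exact ⟨a, a, rfl, rfl, le_rfl⟩
  le_trans x y z := by
    induction x using QuotientAddGroup.induction_on with
    | H a =>
    induction y using QuotientAddGroup.induction_on with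
    | H b =>
    induction z using QuotientAddGroup.induction_on with
    | H c =>
    simp only [quotient_mk_le_mk]
    rintro ⟨h, hh, hab⟩ ⟨k, hk, hbc⟩
    refine ⟨k + h, H.toAddSubgroup.add_mem hk hh, hab.trans ?_⟩
    rw [← add_assoc]
    exact add_le_add_left hbc h
  le_antisymm x y := by
    induction x using QuotientAddGroup.induction_on with
    | H a =>
    induction y using QuotientAddGroup.induction_on with
    | H b =>
    simp only [quotient_mk_le_mk]
    rintro ⟨h, hh, hab⟩ ⟨k, hk, hba⟩
    rw [QuotientAddGroup.eq]
    refine H.ordConnected'.out (H.toAddSubgroup.neg_mem hh) hk ⟨?_, ?_⟩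
    · rw [neg_add_eq_sub, neg_le_sub_iff_le_add]
      exact hab
    · rw [neg_add_eq_sub, sub_le_iff_le_add']
      exact hba
  le_total x y := by
    induction x using QuotientAddGroup.induction_on with
    | H a =>
    induction y using QuotientAddGroup.induction_on with
    | H b =>
    exact (le_total a b).imp (fun h => ⟨a, b, rfl, rfl, h⟩) (fun h => ⟨b, a, rfl, rfl, h⟩)
  toDecidableLE := Classical.decRel _

instance quotientIsOrderedAddMonoid (H : ConvexAddSubgroup G) :
    IsOrderedAddMonoid (G ⧸ H.toAddSubgroup) where
  add_le_add_left := by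
    rintro x y ⟨a, b, rfl, rfl, hab⟩ z
    induction z using QuotientAddGroup.induction_on with
    | H c => exact ⟨a + c, b + c, rfl, rfl, add_le_add_left hab c⟩

end Quotient

/-! ### Divisibility -/

/-- An abelian group is `n`-divisible if every element is an `n`-th multiple. -/
def IsNDivisible (n : ℕ) (A : Type*) [AddCommGroup A] : Prop :=
  ∀ x : A, ∃ y : A, n • y = x

/-- The ordered abelian group `A` has a non-trivial `n`-divisible convex subgroup. -/
def HasNontrivialNDivisibleConvexSubgroup (n : ℕ) (A : Type*) [AddCommGroup A]
    [LinearOrder A] : Prop :=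
  ∃ K : ConvexAddSubgroup A, K.toAddSubgroup ≠ ⊥ ∧ IsNDivisible n K.toAddSubgroup

/-! ### The natural valuation of an ordered abelian group -/

/-- `Φ_G(H) = v_G(H \ {0})`, where `v_G` sends an element of `G` to its archimedean class. In
`ArchimedeanClass G` the class of `a` is smaller than the class of `b` iff `n|b| < |a|` for all
natural numbers `n`. -/
def Phi {G : Type*} [AddCommGroup G] [LinearOrder G] [IsOrderedAddMonoid G]
    (H : AddSubgroup G) : Set (ArchimedeanClass G) :=
  ArchimedeanClass.mk '' ((H : Set G) \ {0})

/-! ### Definability -/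

/-- The subgroup `H` of `G` is definable in the language of ordered groups by a formula with
parameters from `G`. -/
def IsLogDefinable {G : Type*} [AddCommGroup G] [LinearOrder G] (H : AddSubgroup G) : Prop :=
  (Set.univ : Set G).Definable₁ Log (H : Set G)

end OrderedGroupDefinability

/-!
For `n ≥ 1` and `x z : G`, the coset `z + nG` meets the convex subgroup `⟨x⟩` generated by `x` if
and only if it contains an element of absolute value at most `n • |x|`: an element of `⟨x⟩` can be
moved into this interval by adding multiples of `n • |x|`, which lie in `nG`
(`exists_abs_add_nsmul_le`). So "`z + nG` meets `⟨x⟩`", which speaks of all natural multiples of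
`|x|`, is a first-order condition on `z` and `x` (`NearMultiple`,
`definable_nearMultiple`), and each conjunct describes `H` by it.

* First conjunct: the elements outside `H` of largest archimedean class generate the smallest
  convex subgroup `C` above `H`. Since `C / H` is not `n`-divisible there is `k ∈ C` with `k + nG`
  disjoint from `H`, and then `x ∈ H` iff `k + nG` does not meet `⟨x⟩`.
* Second conjunct: let `c ∉ H` lie in the preimage of the `n`-divisible convex subgroup. Then `x ∈
  H` iff some `k` with `|k| ≤ |c|` has `k + nG` disjoint from `⟨x⟩`: for `x ∈ H` such a `k` exists
  in `H` because `H / ⟨x⟩` is not `n`-divisible, and for `x ∉ H` every such `k` is in `H + nG`.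
* Third and fourth conjunct: there is `h₀ ∈ H` with `H ⊆ ⟨h₀⟩ + nG`, namely a generator of `H` as a
  convex subgroup, respectively any element of `H \ H'`. So `k + nG` meets `H` iff it meets `⟨h₀⟩`,
  and `x ∉ H` iff some `k` with `|k| ≤ n • |x|` has `k + nG` disjoint from `⟨h₀⟩`.
-/

namespace OrderedGroupDefinability

open FirstOrder FirstOrder.Language Set

/-! ### Definability of linear inequalities -/

section Definability

variable {G : Type*} [AddCommGroup G] [LinearOrder G] {α : Type*}

theorem termDefinable_coord (i : α) :
    (univ : Set G).TermDefinable Log (fun v : α → G => v i) :=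
  ⟨Term.var i, by ext v; simp⟩

theorem termDefinable_param (a : G) :
    (univ : Set G).TermDefinable Log (fun _ : α → G => a) :=
  ⟨(Log.con (⟨a, mem_univ a⟩ : (univ : Set G))).term, by ext v; simp⟩

theorem termDefinable_zero :
    (univ : Set G).TermDefinable Log (fun _ : α → G => (0 : G)) :=
  termDefinable_param 0

theorem termDefinable_neg {f : (α → G) → G} (hf : (univ : Set G).TermDefinable Log f) :
    (univ : Set G).TermDefinable Log (fun v => -f v) := by
  obtain ⟨s, rfl⟩ := hf
  refine ⟨Functions.apply₁ (L := Log[[(univ : Set G)]]) (Sum.inl LogFunc.neg) s, ?_⟩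
  ext v
  exact (Term.realize_functions_apply₁ (L := Log[[(univ : Set G)]]) (f := Sum.inl LogFunc.neg)).symm

theorem termDefinable_add {f g : (α → G) → G} (hf : (univ : Set G).TermDefinable Log f)
    (hg : (univ : Set G).TermDefinable Log g) :
    (univ : Set G).TermDefinable Log (fun v => f v + g v) := by
  obtain ⟨s, rfl⟩ := hf
  obtain ⟨t, rfl⟩ := hg
  refine ⟨Functions.apply₂ (L := Log[[(univ : Set G)]]) (Sum.inl LogFunc.add) s t, ?_⟩
  ext v
  exact (Term.realize_functions_apply₂ (L := Log[[(univ : Set G)]]) (f := Sum.inl LogFunc.add)).symm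

theorem termDefinable_nsmul {f : (α → G) → G} (hf : (univ : Set G).TermDefinable Log f) (n : ℕ) :
    (univ : Set G).TermDefinable Log (fun v => n • f v) := by
  induction n with
  | zero => simpa only [zero_nsmul] using termDefinable_zero
  | succ n ih => simpa only [succ_nsmul] using termDefinable_add ih hf

theorem definable_lt {f g : (α → G) → G} (hf : (univ : Set G).TermDefinable Log f)
    (hg : (univ : Set G).TermDefinable Log g) :
    (univ : Set G).Definable Log {v | f v < g v} := by
  obtain ⟨s, rfl⟩ := hf
  obtain ⟨t, rfl⟩ := hg
  refine ⟨Relations.formula₂ (L := Log[[(univ : Set G)]]) (Sum.inl LogRel.lt) s t, ?_⟩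
  ext v
  exact (Formula.realize_rel₂ (L := Log[[(univ : Set G)]]) (M := G) (R := Sum.inl LogRel.lt)).symm

theorem definable_le {f g : (α → G) → G} (hf : (univ : Set G).TermDefinable Log f)
    (hg : (univ : Set G).TermDefinable Log g) :
    (univ : Set G).Definable Log {v | f v ≤ g v} := by
  convert (definable_lt hg hf).compl using 1
  ext v
  simp

theorem definable_abs_le_nsmul_abs [IsOrderedAddMonoid G] {f g : (α → G) → G}
    (hf : (univ : Set G).TermDefinable Log f)
    (hg : (univ : Set G).TermDefinable Log g) (n : ℕ) :
    (univ : Set G).Definable Log {v | |f v| ≤ n • |g v|} := by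
  have key : ∀ {e : (α → G) → G}, (univ : Set G).TermDefinable Log e →
      (univ : Set G).Definable Log {v | e v ≤ n • |g v|} := by
    intro e he
    convert (definable_le he (termDefinable_nsmul hg n)).union
      (definable_le he (termDefinable_nsmul (termDefinable_neg hg) n)) using 1
    ext v
    simp only [mem_ofPred_eq, mem_union]
    constructor
    · rcases abs_choice (g v) with h | h <;> rw [h]
      · exact Or.inl
      · exact Or.inr
    · rintro (h | h)
      · exact h.trans (nsmul_le_nsmul_right (le_abs_self _) n)
      · exact h.trans (nsmul_le_nsmul_right (neg_le_abs _) n)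
  convert (key hf).inter (key (termDefinable_neg hf)) using 1
  ext v
  simp only [mem_ofPred_eq, mem_inter_iff, abs_le']

end Definability

/-! ### Cosets of `nG` meeting principal convex subgroups -/

variable {G : Type*} [AddCommGroup G] [LinearOrder G] [IsOrderedAddMonoid G]

/-- `z + nG` contains an element of absolute value at most `n • |x|`. For `n ≥ 1` this says that
`z + nG` meets the convex subgroup generated by `x`. -/
def NearMultiple (n : ℕ) (z x : G) : Prop :=
  ∃ y : G, |z + n • y| ≤ n • |x|

theorem definable_nearMultiple {α : Type*} {f g : (α → G) → G}
    (hf : (univ : Set G).TermDefinable Log f)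
    (hg : (univ : Set G).TermDefinable Log g) (n : ℕ) :
    (univ : Set G).Definable Log {v | NearMultiple n (f v) (g v)} := by
  have lift : ∀ {e : (α → G) → G}, (univ : Set G).TermDefinable Log e →
      (univ : Set G).TermDefinable Log (fun w : α ⊕ Unit → G => e (fun i => w (Sum.inl i))) :=
    fun he => he.comp fun i => termDefinable_coord (Sum.inl i)
  convert (definable_abs_le_nsmul_abs
    (termDefinable_add (lift hf) (termDefinable_nsmul (termDefinable_coord (Sum.inr ())) n))
    (lift hg) n).exists_of_finite using 1
  ext v
  simp only [NearMultiple, mem_ofPred_eq, Sum.elim_inl, Sum.elim_inr]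
  exact ⟨fun ⟨y, hy⟩ => ⟨fun _ => y, hy⟩, fun ⟨u, hu⟩ => ⟨u (), hu⟩⟩

theorem exists_sub_nsmul_mem_Icc {c : G} (hc : 0 ≤ c) (m : ℕ) :
    ∀ b : G, 0 ≤ b → b ≤ m • c → ∃ k : ℕ, 0 ≤ b - k • c ∧ b - k • c ≤ c := by
  induction m with
  | zero => exact fun b h0 h1 => ⟨0, by simpa using h0, by simpa using h1.trans (by simpa using hc)⟩
  | succ m ih =>
    intro b h0 h1
    rcases le_total b c with h | h
    · exact ⟨0, by simpa using h0, by simpa using h⟩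
    · obtain ⟨k, hk⟩ := ih (b - c) (sub_nonneg.2 h)
        (by rw [sub_le_iff_le_add, ← succ_nsmul]; exact h1)
      refine ⟨k + 1, ?_⟩
      rwa [succ_nsmul', ← sub_sub]

/-- An element of the convex subgroup generated by `x` is congruent modulo `nG` to one of absolute
value at most `n • |x|`. -/
theorem exists_abs_add_nsmul_le {n : ℕ} (hn : 1 ≤ n) {b x : G} {m : ℕ} (h : |b| ≤ m • |x|) :
    ∃ y : G, |b + n • y| ≤ n • |x| := by
  have hx := abs_nonneg x
  have hb := abs_le.1 h
  have hc : 0 ≤ n • |x| := nsmul_nonneg hx n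
  have hm : m • |x| ≤ m • n • |x| :=
    nsmul_le_nsmul_right (by simpa using nsmul_le_nsmul_left hx hn) m
  obtain ⟨k, hk0, hk1⟩ := exists_sub_nsmul_mem_Icc hc (m + m) (b + m • n • |x|)
    (neg_le_iff_add_nonneg.1 ((neg_le_neg hm).trans hb.1))
    (by rw [add_nsmul]; exact add_le_add_left (hb.2.trans hm) _)
  refine ⟨m • |x| - k • |x|, ?_⟩
  have e : b + n • (m • |x| - k • |x|) = b + m • n • |x| - k • n • |x| := by
    rw [nsmul_sub, smul_comm n m, smul_comm n k, add_sub_assoc]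
  rwa [e, abs_of_nonneg hk0]

theorem nearMultiple_of_abs_le {n : ℕ} (hn : 1 ≤ n) {z x y : G} {m : ℕ}
    (h : |z + n • y| ≤ m • |x|) : NearMultiple n z x := by
  obtain ⟨y', hy'⟩ := exists_abs_add_nsmul_le hn h
  exact ⟨y + y', by rwa [nsmul_add, ← add_assoc]⟩

/-! ### Convex subgroups -/

namespace ConvexAddSubgroup

theorem mem_of_abs_le (H : ConvexAddSubgroup G) {x h : G} (hh : h ∈ H.toAddSubgroup)
    (hx : |x| ≤ |h|) : x ∈ H.toAddSubgroup := by
  have ha : |h| ∈ H.toAddSubgroup := by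
    rcases abs_choice h with e | e <;> rw [e]
    · exact hh
    · exact H.toAddSubgroup.neg_mem hh
  exact H.ordConnected'.out (H.toAddSubgroup.neg_mem ha) ha (abs_le.1 hx)

theorem mem_of_abs_le_nsmul (H : ConvexAddSubgroup G) {x h : G} (hh : h ∈ H.toAddSubgroup) {m : ℕ}
    (hx : |x| ≤ m • |h|) : x ∈ H.toAddSubgroup :=
  H.mem_of_abs_le (H.toAddSubgroup.nsmul_mem hh m) (by rwa [abs_nsmul])

theorem abs_le_of_notMem (H : ConvexAddSubgroup G) {x h : G} (hh : h ∈ H.toAddSubgroup)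
    (hx : x ∉ H.toAddSubgroup) : |h| ≤ |x| :=
  le_of_not_ge fun hle => hx (H.mem_of_abs_le hh hle)

/-- The convex subgroup generated by `x`. -/
def principal (x : G) : ConvexAddSubgroup G where
  carrier := {k | ∃ m : ℕ, |k| ≤ m • |x|}
  zero_mem' := ⟨0, by simp⟩
  add_mem' := by
    rintro a b ⟨m, hm⟩ ⟨k, hk⟩
    exact ⟨m + k, (abs_add_le a b).trans (by rw [add_nsmul]; exact add_le_add hm hk)⟩
  neg_mem' := by
    rintro a ⟨m, hm⟩
    exact ⟨m, by rwa [abs_neg]⟩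
  ordConnected' := by
    refine ⟨?_⟩
    rintro a ⟨m, hm⟩ b ⟨k, hk⟩ c ⟨hac, hcb⟩
    refine ⟨m + k, ?_⟩
    rw [add_nsmul]
    exact (abs_le_max_abs_abs hac hcb).trans
      ((max_le_add_of_nonneg (abs_nonneg a) (abs_nonneg b)).trans (add_le_add hm hk))

theorem mem_principal {x k : G} :
    k ∈ (principal x).toAddSubgroup ↔ ∃ m : ℕ, |k| ≤ m • |x| :=
  Iff.rfl

theorem self_mem_principal (x : G) : x ∈ (principal x).toAddSubgroup :=
  mem_principal.2 ⟨1, by simp⟩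

theorem principal_le (H : ConvexAddSubgroup G) {x : G} (hx : x ∈ H.toAddSubgroup) :
    (principal x).toAddSubgroup ≤ H.toAddSubgroup :=
  fun _ ⟨_, hm⟩ => H.mem_of_abs_le_nsmul hx hm

theorem le_principal (H : ConvexAddSubgroup G) {x : G} (hx : x ∉ H.toAddSubgroup) :
    H.toAddSubgroup ≤ (principal x).toAddSubgroup :=
  fun _ hh => mem_principal.2 ⟨1, by simpa using H.abs_le_of_notMem hh hx⟩

/-- The image in `G ⧸ H` of a convex subgroup of `G` containing `H`. -/
def mapQuotient (H C : ConvexAddSubgroup G) (hHC : H.toAddSubgroup ≤ C.toAddSubgroup) :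
    ConvexAddSubgroup (G ⧸ H.toAddSubgroup) where
  toAddSubgroup := C.toAddSubgroup.map (QuotientAddGroup.mk' H.toAddSubgroup)
  ordConnected' := by
    refine ⟨?_⟩
    rintro _ ⟨a, ha, rfl⟩ _ ⟨b, hb, rfl⟩ q ⟨haq, hqb⟩
    induction q using QuotientAddGroup.induction_on with
    | H c =>
    obtain ⟨h, hh, hac⟩ := (quotient_mk_le_mk H a c).1 haq
    obtain ⟨k, hk, hcb⟩ := (quotient_mk_le_mk H c b).1 hqb
    refine ⟨c, C.ordConnected'.out (C.toAddSubgroup.sub_mem ha (hHC hh))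
      (C.toAddSubgroup.add_mem hb (hHC hk)) ⟨sub_le_iff_le_add.2 hac, hcb⟩, rfl⟩

end ConvexAddSubgroup

open ConvexAddSubgroup

/-- If `G ⧸ H` has no non-trivial `n`-divisible convex subgroup, then every convex subgroup above
`H`, in particular the one generated by `x ∉ H`, has an element outside `H + nG`. -/
theorem exists_mem_principal_forall_add_nsmul_notMem {n : ℕ} (hn : 1 ≤ n) (H : ConvexAddSubgroup G)
    (hdiv : ¬ HasNontrivialNDivisibleConvexSubgroup n (G ⧸ H.toAddSubgroup)) {x : G}
    (hx : x ∉ H.toAddSubgroup) :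
    ∃ k ∈ (principal x).toAddSubgroup, ∀ y : G, k + n • y ∉ H.toAddSubgroup := by
  by_contra! hcon
  have hHC := H.le_principal hx
  refine hdiv ⟨mapQuotient H (principal x) hHC, fun hbot => hx ?_, ?_⟩
  · have hmem : (x : G ⧸ H.toAddSubgroup) ∈ (mapQuotient H (principal x) hHC).toAddSubgroup :=
      ⟨x, self_mem_principal x, rfl⟩
    rw [hbot, AddSubgroup.mem_bot] at hmem
    exact (QuotientAddGroup.eq_zero_iff x).1 hmem
  · rintro ⟨_, k, hk, rfl⟩
    obtain ⟨y, hy⟩ := hcon k hk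
    have hny : n • y ∈ (principal x).toAddSubgroup := by
      simpa using (principal x).toAddSubgroup.sub_mem (hHC hy) hk
    have hyC : y ∈ (principal x).toAddSubgroup := by
      refine (principal x).mem_of_abs_le hny ?_
      rw [abs_nsmul]
      simpa using nsmul_le_nsmul_left (abs_nonneg y) hn
    refine ⟨⟨((-y : G) : G ⧸ H.toAddSubgroup), -y, (principal x).toAddSubgroup.neg_mem hyC, rfl⟩,
      Subtype.ext ?_⟩
    refine (QuotientAddGroup.eq (a := n • -y) (b := k)).2 ?_
    simpa [add_comm] using hy

theorem mk_mem_Phi (H : ConvexAddSubgroup G) {x : G} :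
    ArchimedeanClass.mk x ∈ Phi H.toAddSubgroup ↔ x ∈ H.toAddSubgroup ∧ x ≠ 0 := by
  constructor
  · rintro ⟨h, ⟨hh, h0⟩, e⟩
    obtain ⟨m, hm⟩ := ArchimedeanClass.mk_le_mk.1 e.le
    refine ⟨H.mem_of_abs_le_nsmul hh hm, ?_⟩
    rintro rfl
    exact h0 (by simpa using e)
  · exact fun h => ⟨x, h, rfl⟩

/-! ### Definitions of `H` -/

/-- `H` is the largest convex subgroup that is disjoint from `k + nG`. -/
theorem isLogDefinable_of_isGreatest {n : ℕ} (hn : 1 ≤ n) (H : ConvexAddSubgroup G)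
    {γ : ArchimedeanClass G}
    (hγ : IsGreatest (Phi (⊤ : AddSubgroup G) \ Phi H.toAddSubgroup) γ)
    (hdiv : ¬ HasNontrivialNDivisibleConvexSubgroup n (G ⧸ H.toAddSubgroup)) :
    IsLogDefinable H.toAddSubgroup := by
  obtain ⟨⟨⟨g, ⟨-, hg0⟩, rfl⟩, hgH⟩, hmax⟩ := hγ
  have hg : g ∉ H.toAddSubgroup := fun h => hgH ((mk_mem_Phi H).2 ⟨h, hg0⟩)
  obtain ⟨k, hk, hkH⟩ := exists_mem_principal_forall_add_nsmul_notMem hn H hdiv hg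
  change (univ : Set G).Definable Log _
  convert (definable_nearMultiple (termDefinable_param k) (termDefinable_coord (0 : Fin 1))
    n).compl using 1
  ext v
  simp only [mem_ofPred_eq, mem_compl_iff, SetLike.mem_coe]
  constructor
  · rintro hv ⟨y, hy⟩
    exact hkH y (H.mem_of_abs_le_nsmul hv hy)
  · intro hnear
    by_contra hv
    have hle : ArchimedeanClass.mk (v 0) ≤ ArchimedeanClass.mk g :=
      hmax ⟨⟨v 0, ⟨trivial, fun h0 => hv (by rw [h0]; exact H.toAddSubgroup.zero_mem)⟩, rfl⟩,
        fun h => hv ((mk_mem_Phi H).1 h).1⟩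
    obtain ⟨m, hm⟩ := (principal (v 0)).principal_le
      (mem_principal.2 (ArchimedeanClass.mk_le_mk.1 hle)) hk
    exact hnear (nearMultiple_of_abs_le hn (y := 0) (m := m) (by simpa using hm))

/-- If `H ≠ 0`, then `x ∈ H` if and only if `[-|c|, |c|]` is not contained in `⟨x⟩ + nG`, where
`c ∉ H` has its coset in the `n`-divisible convex subgroup of `G ⧸ H`. -/
theorem isLogDefinable_of_divisible_above {n : ℕ} (hn : 1 ≤ n) (H : ConvexAddSubgroup G)
    (hdiv : HasNontrivialNDivisibleConvexSubgroup n (G ⧸ H.toAddSubgroup))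
    (hmin : ¬ ∃ γ, IsLeast (Phi H.toAddSubgroup) γ)
    (hH' : ∀ H' : ConvexAddSubgroup G, H'.toAddSubgroup < H.toAddSubgroup →
      ¬ IsNDivisible n (H.toAddSubgroup ⧸ H'.toAddSubgroup.addSubgroupOf H.toAddSubgroup)) :
    IsLogDefinable H.toAddSubgroup := by
  change (univ : Set G).Definable Log _
  -- For `H = 0` the hypotheses on `Φ(H)` and on the quotients `H / H'` are vacuous, and `H / ⟨0⟩`
  -- is `n`-divisible, so the description used below would be empty.
  by_cases hbot : H.toAddSubgroup = ⊥
  · convert definable_abs_le_nsmul_abs (termDefinable_coord (G := G) (0 : Fin 1))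
      termDefinable_zero 0 using 1
    ext v
    simp [hbot]
  obtain ⟨K, hK, hKdiv⟩ := hdiv
  obtain ⟨q, hqK, hq⟩ := K.toAddSubgroup.bot_or_exists_ne_zero.resolve_left hK
  induction q using QuotientAddGroup.induction_on with
  | H c =>
  have hc : c ∉ H.toAddSubgroup := fun h => hq ((QuotientAddGroup.eq_zero_iff c).2 h)
  have hcK : ((|c| : G) : G ⧸ H.toAddSubgroup) ∈ K.toAddSubgroup := by
    rcases abs_choice c with e | e <;> rw [e]
    · exact hqK
    · exact K.toAddSubgroup.neg_mem hqK
  have hdef : (univ : Set G).Definable Log {v : Fin 1 → G | ∃ u : Unit → G,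
      Sum.elim v u ∈ {w : Fin 1 ⊕ Unit → G | |w (Sum.inr ())| ≤ 1 • |c|} ∩
        {w : Fin 1 ⊕ Unit → G | NearMultiple n (w (Sum.inr ())) (w (Sum.inl 0))}ᶜ} :=
    ((definable_abs_le_nsmul_abs (termDefinable_coord _) (termDefinable_param c) 1).inter
      (definable_nearMultiple (termDefinable_coord _) (termDefinable_coord _)
        n).compl).exists_of_finite
  convert hdef using 1
  ext v
  simp only [mem_ofPred_eq, mem_inter_iff, mem_compl_iff, Sum.elim_inl, Sum.elim_inr, one_nsmul,
    SetLike.mem_coe]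
  constructor
  · intro hv
    have hlt : (principal (v 0)).toAddSubgroup < H.toAddSubgroup := by
      refine lt_of_le_not_ge (H.principal_le hv) fun hle => hmin ⟨ArchimedeanClass.mk (v 0), ?_, ?_⟩
      · refine (mk_mem_Phi H).2 ⟨hv, fun h0 => hbot ((AddSubgroup.eq_bot_iff_forall _).2 ?_)⟩
        intro h hh
        obtain ⟨m, hm⟩ := hle hh
        simpa [h0] using hm
      · rintro _ ⟨h, ⟨hh, -⟩, rfl⟩
        exact ArchimedeanClass.mk_le_mk.2 (hle hh)
    have hnot := hH' _ hlt
    simp only [IsNDivisible, not_forall] at hnot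
    obtain ⟨p, hp⟩ := hnot
    induction p using QuotientAddGroup.induction_on with
    | H k =>
    refine ⟨fun _ => k, H.abs_le_of_notMem k.2 hc, ?_⟩
    rintro ⟨y, hy⟩
    have hmem : (k : G) + n • y ∈ (principal (v 0)).toAddSubgroup := ⟨n, hy⟩
    have hny : n • y ∈ H.toAddSubgroup := by
      simpa using H.toAddSubgroup.sub_mem (H.principal_le hv hmem) k.2
    have hyH : y ∈ H.toAddSubgroup := by
      refine H.mem_of_abs_le hny ?_
      rw [abs_nsmul]
      simpa using nsmul_le_nsmul_left (abs_nonneg y) hn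
    refine hp ⟨((-⟨y, hyH⟩ : H.toAddSubgroup) : H.toAddSubgroup ⧸ _), ?_⟩
    refine (QuotientAddGroup.eq (a := n • -(⟨y, hyH⟩ : H.toAddSubgroup)) (b := k)).2 ?_
    rw [AddSubgroup.mem_addSubgroupOf]
    simpa [add_comm] using hmem
  · rintro ⟨u, huc, hu⟩
    by_contra hv
    have huK : ((u () : G) : G ⧸ H.toAddSubgroup) ∈ K.toAddSubgroup :=
      K.ordConnected'.out (K.toAddSubgroup.neg_mem hcK) hcK
        ⟨⟨-|c|, u (), rfl, rfl, (abs_le.1 huc).1⟩, ⟨u (), |c|, rfl, rfl, (abs_le.1 huc).2⟩⟩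
    obtain ⟨⟨z, hz⟩, hzu⟩ := hKdiv ⟨_, huK⟩
    induction z using QuotientAddGroup.induction_on with
    | H z =>
    have hmem := (QuotientAddGroup.eq (a := n • z) (b := u ())).1 (congrArg Subtype.val hzu)
    refine hu (nearMultiple_of_abs_le hn (y := -z) (m := 1) ?_)
    rw [one_nsmul]
    refine H.abs_le_of_notMem ?_ hv
    simpa [add_comm] using hmem

/-- The common form of the cases where `H` is, modulo `nG`, generated as a convex subgroup by a
single element `h₀`. -/
theorem isLogDefinable_of_forall_nearMultiple {n : ℕ} (hn : 1 ≤ n) (H : ConvexAddSubgroup G)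
    (hdiv : ¬ HasNontrivialNDivisibleConvexSubgroup n (G ⧸ H.toAddSubgroup)) {h₀ : G}
    (h₀H : h₀ ∈ H.toAddSubgroup) (hnear : ∀ h ∈ H.toAddSubgroup, NearMultiple n h h₀) :
    IsLogDefinable H.toAddSubgroup := by
  change (univ : Set G).Definable Log _
  have hdef : (univ : Set G).Definable Log {v : Fin 1 → G | ∃ u : Unit → G,
      Sum.elim v u ∈ {w : Fin 1 ⊕ Unit → G | |w (Sum.inr ())| ≤ n • |w (Sum.inl 0)|} ∩
        {w : Fin 1 ⊕ Unit → G | NearMultiple n (w (Sum.inr ())) h₀}ᶜ} :=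
    ((definable_abs_le_nsmul_abs (termDefinable_coord _) (termDefinable_coord _) n).inter
      (definable_nearMultiple (termDefinable_coord _) (termDefinable_param _)
        n).compl).exists_of_finite
  convert hdef.compl using 1
  ext v
  simp only [mem_ofPred_eq, mem_inter_iff, mem_compl_iff, Sum.elim_inl, Sum.elim_inr,
    SetLike.mem_coe]
  constructor
  · rintro hv ⟨u, huv, hu⟩
    exact hu (hnear _ (H.mem_of_abs_le_nsmul hv huv))
  · intro hcon
    by_contra hv
    obtain ⟨k, ⟨m, hm⟩, hk⟩ := exists_mem_principal_forall_add_nsmul_notMem hn H hdiv hv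
    obtain ⟨y, hy⟩ := exists_abs_add_nsmul_le hn hm
    refine hcon ⟨fun _ => k + n • y, hy, ?_⟩
    rintro ⟨z, hz⟩
    refine hk (y + z) (H.mem_of_abs_le_nsmul h₀H (m := n) ?_)
    rwa [nsmul_add, ← add_assoc]

end OrderedGroupDefinability

open OrderedGroupDefinability in
theorem mainTheorem7 {G : Type*} [AddCommGroup G] [LinearOrder G] [IsOrderedAddMonoid G]
    (H : ConvexAddSubgroup G) (hH : H.toAddSubgroup ≠ ⊤) :
    -- (1)
    (((∃ γ, IsGreatest (Phi (⊤ : AddSubgroup G) \ Phi H.toAddSubgroup) γ) ∧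
        ∃ n : ℕ, 2 ≤ n ∧ ¬ HasNontrivialNDivisibleConvexSubgroup n (G ⧸ H.toAddSubgroup)) →
      IsLogDefinable H.toAddSubgroup) ∧
    -- (2)
    ((∃ n : ℕ, 2 ≤ n ∧ HasNontrivialNDivisibleConvexSubgroup n (G ⧸ H.toAddSubgroup) ∧
        (¬ ∃ γ, IsLeast (Phi H.toAddSubgroup) γ) ∧
        ∀ H' : ConvexAddSubgroup G, H'.toAddSubgroup < H.toAddSubgroup →
          ¬ IsNDivisible n
            (H.toAddSubgroup ⧸ H'.toAddSubgroup.addSubgroupOf H.toAddSubgroup)) →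
      IsLogDefinable H.toAddSubgroup) ∧
    -- (3)
    ((∃ n : ℕ, 2 ≤ n ∧ ¬ HasNontrivialNDivisibleConvexSubgroup n (G ⧸ H.toAddSubgroup) ∧
        ∃ γ, IsLeast (Phi H.toAddSubgroup) γ) →
      IsLogDefinable H.toAddSubgroup) ∧
    -- (4)
    ((∃ n : ℕ, 2 ≤ n ∧ ¬ HasNontrivialNDivisibleConvexSubgroup n (G ⧸ H.toAddSubgroup) ∧
        ∃ H' : ConvexAddSubgroup G, H'.toAddSubgroup < H.toAddSubgroup ∧
          IsNDivisible n
            (H.toAddSubgroup ⧸ H'.toAddSubgroup.addSubgroupOf H.toAddSubgroup)) →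
      IsLogDefinable H.toAddSubgroup) := by 
  refine ⟨?_, ?_, ?_, ?_⟩
  · rintro ⟨⟨γ, hγ⟩, n, hn, hdiv⟩
    exact isLogDefinable_of_isGreatest (one_le_two.trans hn) H hγ hdiv
  · rintro ⟨n, hn, hdiv, hmin, hH'⟩
    exact isLogDefinable_of_divisible_above (one_le_two.trans hn) H hdiv hmin hH'
  · rintro ⟨n, hn, hdiv, _, ⟨h₀, ⟨h₀H, -⟩, rfl⟩, hleast⟩
    have hn1 := one_le_two.trans hn
    refine isLogDefinable_of_forall_nearMultiple hn1 H hdiv h₀H fun h hh => ?_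
    by_cases h0 : h = 0
    · exact nearMultiple_of_abs_le hn1 (y := 0) (m := 0) (by simp [h0])
    · obtain ⟨m, hm⟩ := ArchimedeanClass.mk_le_mk.1 (hleast ⟨h, ⟨hh, h0⟩, rfl⟩)
      exact nearMultiple_of_abs_le hn1 (y := 0) (m := m) (by simpa using hm)
  · rintro ⟨n, hn, hdiv, H', hlt, hH'⟩
    have hn1 := one_le_two.trans hn
    obtain ⟨h₀, h₀H, h₀H'⟩ := SetLike.exists_of_lt hlt
    refine isLogDefinable_of_forall_nearMultiple hn1 H hdiv h₀H fun h hh => ?_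
    obtain ⟨z, hz⟩ := hH' ((⟨h, hh⟩ : H.toAddSubgroup) : H.toAddSubgroup ⧸ _)
    induction z using QuotientAddGroup.induction_on with
    | H z =>
    have hmem := (QuotientAddGroup.eq (a := n • z) (b := (⟨h, hh⟩ : H.toAddSubgroup))).1 hz
    rw [AddSubgroup.mem_addSubgroupOf] at hmem
    refine nearMultiple_of_abs_le hn1 (y := -(z : G)) (m := 1) ?_
    rw [one_nsmul]
    exact H'.abs_le_of_notMem (by simpa [add_comm] using hmem) h₀H'
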